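/- An inner gate of a network is either an affine gate, computing $(y_1,\dots,y_r)\mapsto \sum_i a_i y_i+b$ with $a_i,b\in\mathbb{R}$, or a ReLU gate, computing $\mathrm{ReLU}(y)=\max\{y,0\}$. A ReLU network with inputs $x_1,\dots,x_n$ is a finite directed acyclic graph whose input gates are the $x_i$ and whose other gates are inner gates, with a designated output gate; it computes a function $\mathbb{R}^n\to\mathbb{R}$. Its depth is the maximum number of ReLU gates on a directed path. The network is monotone if every affine gate in it computes a monotone function of its inputs for the coordinatewise order (equivalently, all its coefficients $a_i$ are nonnegative; the bias $b$ is arbitrary). Let $\mathrm{ReLU}^+_{n,k}$ be the set of functions $f:\mathbb{R}^n\to\mathbb{R}$ that are computed exactly, on all of $\mathbb{R}^n$, by a depth-$k$ monotone ReLU network, with no restriction on its (finite) size. Define $\mathsf{m}_0=0$ and, for $n>0$, $$\mathsf{m}_n(x_1,\dots,x_n)=\mathrm{ReLU}\bigl(x_n+\mathsf{m}_{n-1}(x_1,\dots,x_{n-1})\bigr).$$ **Theorem.** For every $n>0$, $\mathsf{m}_n\in\mathrm{ReLU}^+_{n,n}$, but for every $k<n$, $\mathsf{m}_n\notin\mathrm{ReLU}^+_{n,k}$.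 -/

import Mathlib

noncomputable section

/-- The rectified linear unit. -/
def relu (t : ℝ) : ℝ := max t 0

/-- An inner gate reading from a set `ι` of earlier nodes: either an affine gate, with finite set `S`
of in-neighbours, weights `a j` for `j ∈ S` and bias `b`, or a ReLU gate with one in-neighbour. -/
inductive ReLUGate (ι : Type) : Type
  | affine (S : Finset ι) (a : ι → ℝ) (b : ℝ) : ReLUGate ι
  | relu (j : ι) : ReLUGate ι

/-- The value of a gate, given the values `w` of the earlier nodes. -/
def ReLUGate.eval {ι : Type} (w : ι → ℝ) : ReLUGate ι → ℝ
  | .affine S a b => ∑ j ∈ S, a j * w j + b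
  | .relu j => _root_.relu (w j)

/-- The maximum number of ReLU gates on a directed path ending at a gate, given the corresponding
numbers `d` for the earlier nodes. -/
def ReLUGate.depth {ι : Type} (d : ι → ℕ) : ReLUGate ι → ℕ
  | .affine S _ _ => S.sup d
  | .relu j => d j + 1

/-- If the gate is an affine gate, then the function that it computes from the values of the earlier
nodes is monotone for the coordinatewise order. -/
def ReLUGate.IsMonotone {ι : Type} : ReLUGate ι → Prop
  | .affine S a b => Monotone (fun w : ι → ℝ => (ReLUGate.affine S a b).eval w)
  | .relu _ => True

/-- A finite directed acyclic graph of `m` inner gates over the input gates `x₁, …, xₙ`. The inner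
gates are listed in a topological order, so each gate reads from the `n` inputs and from the
inner gates listed before it. -/
inductive ReLUGraph (n : ℕ) : ℕ → Type
  | nil : ReLUGraph n 0
  | snoc {m : ℕ} (G : ReLUGraph n m) (g : ReLUGate (Fin n ⊕ Fin m)) : ReLUGraph n (m + 1)

/-- The values of the inner gates on the input `x`. -/
def ReLUGraph.gateVal {n : ℕ} (x : Fin n → ℝ) : {m : ℕ} → ReLUGraph n m → Fin m → ℝ
  | _, .nil => Fin.elim0
  | _, .snoc G g =>
      Fin.snoc (α := fun _ => ℝ) (G.gateVal x) (g.eval (Sum.elim x (G.gateVal x)))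

/-- For each inner gate, the maximum number of ReLU gates on a directed path ending at it. -/
def ReLUGraph.gateDepth {n : ℕ} : {m : ℕ} → ReLUGraph n m → Fin m → ℕ
  | _, .nil => Fin.elim0
  | _, .snoc G g =>
      Fin.snoc (α := fun _ => ℕ) G.gateDepth (g.depth (Sum.elim (fun _ => 0) G.gateDepth))

/-- Every affine gate of the graph computes a monotone function. -/
def ReLUGraph.IsMonotone {n : ℕ} : {m : ℕ} → ReLUGraph n m → Prop
  | _, .nil => True
  | _, .snoc G g => G.IsMonotone ∧ g.IsMonotone

/-- A ReLU network with `n` inputs: a finite directed acyclic graph of gates with a chosen output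
node. -/
structure ReLUNetwork (n : ℕ) where
  /-- The number of inner gates. -/
  size : ℕ
  /-- The gates. -/
  graph : ReLUGraph n size
  /-- The output node. -/
  output : Fin n ⊕ Fin size

namespace ReLUNetwork

/-- The function `ℝⁿ → ℝ` computed by the network. -/
def eval {n : ℕ} (N : ReLUNetwork n) (x : Fin n → ℝ) : ℝ :=
  Sum.elim x (N.graph.gateVal x) N.output

/-- The maximum number of ReLU gates on a directed path in the network. -/
def depth {n : ℕ} (N : ReLUNetwork n) : ℕ :=
  Finset.univ.sup N.graph.gateDepth

/-- A monotone ReLU network: every affine gate computes a monotone function. -/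
def IsMonotone {n : ℕ} (N : ReLUNetwork n) : Prop :=
  N.graph.IsMonotone

end ReLUNetwork

/-- The set of functions `ℝⁿ → ℝ` computable by a depth-`k` monotone ReLU network. -/
def MonotoneReLU (n k : ℕ) : Set ((Fin n → ℝ) → ℝ) :=
  {f | ∃ N : ReLUNetwork n, N.IsMonotone ∧ N.depth = k ∧ ∀ x, N.eval x = f x}

/-- `m₀ = 0` and `mₙ(x) = ReLU(xₙ + mₙ₋₁(x₁, …, xₙ₋₁))` for `n > 0`. -/
def iteratedReLU : (n : ℕ) → (Fin n → ℝ) → ℝ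
  | 0, _ => 0
  | n + 1, x => relu (x (Fin.last n) + iteratedReLU n (fun i => x i.castSucc))

end

/-! Write `m_n` for `iteratedReLU n`. The lower bound is a rigidity argument: a term of depth below
`n` that is affine on every segment where `m_n` is affine must be affine everywhere
(`MonotoneReLUTerm.segmentAffine`), and `m_n` itself is not. Terms are convex, so the hypothesis
passes from a sum to its summands, which leaves terms `relu g`. Such a term is monotone and
nonnegative, hence equals `c * m_n + b` with `c, b ≥ 0` (`eq_mul_iteratedReLU_add`). If `b > 0`, the
outer `relu` is idle and can be removed. If `b = 0 < c`, fixing the last input at `1` makes `relu g`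
positive, so there `g` equals `c * m_{n-1} + c` with one `relu` fewer, and induction on `n` makes
`m_{n-1}` affine, a contradiction. -/

/-- The functions obtained from coordinates and constants by sums, nonnegative scaling and at most
`k` nested applications of `relu`. -/
inductive MonotoneReLUTerm (n : ℕ) : ℕ → ((Fin n → ℝ) → ℝ) → Prop
  | coord (k : ℕ) (i : Fin n) : MonotoneReLUTerm n k (fun x => x i)
  | const (k : ℕ) (c : ℝ) : MonotoneReLUTerm n k (fun _ => c)
  | add {k : ℕ} {f g : (Fin n → ℝ) → ℝ} : MonotoneReLUTerm n k f → MonotoneReLUTerm n k g →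
      MonotoneReLUTerm n k (fun x => f x + g x)
  | smul {k : ℕ} {f : (Fin n → ℝ) → ℝ} (a : ℝ) : 0 ≤ a → MonotoneReLUTerm n k f →
      MonotoneReLUTerm n k (fun x => a * f x)
  | relu {k : ℕ} {f : (Fin n → ℝ) → ℝ} : MonotoneReLUTerm n k f →
      MonotoneReLUTerm n (k + 1) (fun x => relu (f x))

/-- The defect of `f` from being affine at a convex combination of `x` and `y`. -/
def convexGap {n : ℕ} (f : (Fin n → ℝ) → ℝ) (x y : Fin n → ℝ) (t : ℝ) : ℝ :=
  t * f x + (1 - t) * f y - f (t • x + (1 - t) • y)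

/-- `f` is affine along each segment along which `g` is affine. -/
def AffineAlong {n : ℕ} (g f : (Fin n → ℝ) → ℝ) : Prop :=
  ∀ x y t, 0 ≤ t → t ≤ 1 → convexGap g x y t = 0 → convexGap f x y t = 0

/-- `f` is affine along every segment. -/
def SegmentAffine {n : ℕ} (f : (Fin n → ℝ) → ℝ) : Prop :=
  ∀ x y t, 0 ≤ t → t ≤ 1 → convexGap f x y t = 0

theorem relu_nonneg (t : ℝ) : 0 ≤ relu t := le_max_right _ _

theorem le_relu (t : ℝ) : t ≤ relu t := le_max_left _ _

theorem relu_mono : Monotone relu := fun _ _ h => max_le_max_right 0 h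

theorem relu_of_nonneg {t : ℝ} (h : 0 ≤ t) : relu t = t := max_eq_left h

theorem relu_of_nonpos {t : ℝ} (h : t ≤ 0) : relu t = 0 := max_eq_right h

theorem relu_eq_self_of_pos {t : ℝ} (h : 0 < relu t) : relu t = t := by
  rcases le_total 0 t with h' | h'
  · exact relu_of_nonneg h'
  · rw [relu_of_nonpos h'] at h
    exact absurd h (lt_irrefl 0)

theorem relu_mul {t : ℝ} (ht : 0 ≤ t) (s : ℝ) : relu (t * s) = t * relu s := by
  unfold relu
  rw [mul_max_of_nonneg _ _ ht, mul_zero]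

/-! ### Monotone networks as convex monotone terms -/

namespace MonotoneReLUTerm

variable {n : ℕ}

theorem mono_depth {k l : ℕ} {f : (Fin n → ℝ) → ℝ} (h : MonotoneReLUTerm n k f) (hkl : k ≤ l) :
    MonotoneReLUTerm n l f := by
  induction h generalizing l with
  | coord k i => exact coord l i
  | const k c => exact const l c
  | add _ _ ihf ihg => exact add (ihf hkl) (ihg hkl)
  | smul a ha _ ih => exact smul a ha (ih hkl)
  | relu _ ih =>
    obtain ⟨l, rfl⟩ := Nat.exists_eq_add_of_le' (Nat.one_le_of_lt hkl)
    exact relu (ih (by omega))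

theorem sum {ι : Type} {k : ℕ} (S : Finset ι) {f : ι → (Fin n → ℝ) → ℝ}
    (h : ∀ j ∈ S, MonotoneReLUTerm n k (f j)) :
    MonotoneReLUTerm n k (fun x => ∑ j ∈ S, f j x) := by
  classical
  induction S using Finset.induction_on with
  | empty => simpa using const k 0
  | insert j S hj ih =>
    simp only [Finset.sum_insert hj]
    exact add (h j (Finset.mem_insert_self j S))
      (ih fun i hi => h i (Finset.mem_insert_of_mem hi))

theorem monotone {k : ℕ} {f : (Fin n → ℝ) → ℝ} (h : MonotoneReLUTerm n k f) : Monotone f := by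
  induction h with
  | coord k i => exact fun x y hxy => hxy i
  | const k c => exact monotone_const
  | add _ _ ihf ihg => exact ihf.add ihg
  | smul a ha _ ih => exact ih.const_mul ha
  | relu _ ih => exact relu_mono.comp ih

theorem convexGap_nonneg {k : ℕ} {f : (Fin n → ℝ) → ℝ} (h : MonotoneReLUTerm n k f)
    (x y : Fin n → ℝ) {t : ℝ} (h0 : 0 ≤ t) (h1 : t ≤ 1) : 0 ≤ convexGap f x y t := by
  unfold convexGap
  induction h with
  | coord k i => simp
  | const k c => simp only; linarith
  | add _ _ ihf ihg => simp only; linarith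
  | smul a ha _ ih => simp only; nlinarith [mul_nonneg ha ih]
  | @relu k f _ ih =>
    have hx := mul_le_mul_of_nonneg_left (le_relu (f x)) h0
    have hy := mul_le_mul_of_nonneg_left (le_relu (f y)) (sub_nonneg.2 h1)
    have hx' := mul_nonneg h0 (relu_nonneg (f x))
    have hy' := mul_nonneg (sub_nonneg.2 h1) (relu_nonneg (f y))
    refine sub_nonneg.2 (max_le ?_ ?_) <;> linarith

theorem snoc {k : ℕ} {f : (Fin (n + 1) → ℝ) → ℝ} (h : MonotoneReLUTerm (n + 1) k f) (c : ℝ) :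
    MonotoneReLUTerm n k (fun x => f (Fin.snoc (α := fun _ => ℝ) x c)) := by
  induction h with
  | coord k i =>
    induction i using Fin.lastCases with
    | last => simpa using const k c
    | cast i => simpa using coord k i
  | const k c => exact const k c
  | add _ _ ihf ihg => exact add ihf ihg
  | smul a ha _ ih => exact smul a ha ih
  | relu _ ih => exact relu ih

theorem of_gate {ι : Type} {w : (Fin n → ℝ) → ι → ℝ} {d : ι → ℕ}
    (hw : ∀ j, MonotoneReLUTerm n (d j) (fun x => w x j)) {g : ReLUGate ι} (hg : g.IsMonotone) :
    MonotoneReLUTerm n (g.depth d) (fun x => g.eval (w x)) := by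
  classical
  cases g with
  | affine S a b =>
    have ha : ∀ j ∈ S, 0 ≤ a j := by
      intro j hj
      -- Comparing the gate at `0` and at a unit vector isolates the weight `a j`.
      have h := hg (show (0 : ι → ℝ) ≤ Pi.single j 1 from Pi.single_nonneg.2 zero_le_one)
      simpa [ReLUGate.eval, Pi.single_apply, hj] using h
    exact add (sum S fun j hj => smul (a j) (ha j hj) ((hw j).mono_depth (Finset.le_sup hj)))
      (const _ b)
  | relu j => exact relu (hw j)

theorem of_gateVal {m : ℕ} {G : ReLUGraph n m} (hG : G.IsMonotone) (i : Fin m) :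
    MonotoneReLUTerm n (G.gateDepth i) (fun x => G.gateVal x i) := by
  induction G with
  | nil => exact i.elim0
  | snoc G g ih =>
    induction i using Fin.lastCases with
    | last =>
      simp only [ReLUGraph.gateVal, ReLUGraph.gateDepth, Fin.snoc_last]
      refine of_gate (fun j => ?_) hG.2
      cases j with
      | inl j => exact coord 0 j
      | inr j => exact ih hG.1 j
    | cast i =>
      simp only [ReLUGraph.gateVal, ReLUGraph.gateDepth, Fin.snoc_castSucc]
      exact ih hG.1 i

theorem of_mem_monotoneReLU {k : ℕ} {f : (Fin n → ℝ) → ℝ} (hf : f ∈ MonotoneReLU n k) :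
    MonotoneReLUTerm n k f := by
  obtain ⟨⟨m, G, o⟩, hN, hk, hf⟩ := hf
  obtain rfl : _ = f := funext hf
  cases o with
  | inl j => exact coord k j
  | inr j =>
    refine (of_gateVal hN j).mono_depth ?_
    rw [← hk]
    exact Finset.le_sup (f := G.gateDepth) (Finset.mem_univ j)

end MonotoneReLUTerm

/-! ### Homogeneity and special values of `iteratedReLU` -/

theorem iteratedReLU_nonneg {n : ℕ} (x : Fin n → ℝ) : 0 ≤ iteratedReLU n x := by
  cases n with
  | zero => exact le_rfl
  | succ n => exact relu_nonneg _

theorem iteratedReLU_smul {n : ℕ} {t : ℝ} (ht : 0 ≤ t) (x : Fin n → ℝ) :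
    iteratedReLU n (t • x) = t * iteratedReLU n x := by
  induction n with
  | zero => simp [iteratedReLU]
  | succ n ih =>
    have h := ih (fun i => x i.castSucc)
    simp only [iteratedReLU, ← relu_mul ht, mul_add, ← h]
    rfl

theorem iteratedReLU_zero (n : ℕ) : iteratedReLU n 0 = 0 := by
  simpa using iteratedReLU_smul (n := n) le_rfl 0

theorem iteratedReLU_of_nonpos {n : ℕ} {x : Fin n → ℝ} (hx : x ≤ 0) : iteratedReLU n x = 0 := by
  induction n with
  | zero => rfl
  | succ n ih =>
    simp only [iteratedReLU, ih (x := fun i => x i.castSucc) fun i => hx i.castSucc, add_zero]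
    exact relu_of_nonpos (hx _)

theorem iteratedReLU_single_last (n : ℕ) (c : ℝ) :
    iteratedReLU (n + 1) (Pi.single (Fin.last n) c) = relu c := by
  have h : (fun i : Fin n => (Pi.single (Fin.last n) c : Fin (n + 1) → ℝ) i.castSucc) = 0 := by
    ext i
    simp [Fin.castSucc_ne_last]
  rw [iteratedReLU, h, iteratedReLU_zero, Pi.single_eq_same, add_zero]

theorem iteratedReLU_sub_single_last {n : ℕ} (x : Fin (n + 1) → ℝ) :
    iteratedReLU (n + 1) (x - Pi.single (Fin.last n) (iteratedReLU (n + 1) x)) = 0 := by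
  have h : (fun i : Fin n =>
      (x - Pi.single (Fin.last n) (iteratedReLU (n + 1) x) : Fin (n + 1) → ℝ) i.castSucc) =
      fun i => x i.castSucc := by
    ext i
    simp [Fin.castSucc_ne_last]
  have h' : x (Fin.last n) + iteratedReLU n (fun i => x i.castSucc) ≤ iteratedReLU (n + 1) x :=
    le_relu _
  rw [iteratedReLU, h]
  refine relu_of_nonpos ?_
  simp only [Pi.sub_apply, Pi.single_eq_same]
  linarith

theorem not_segmentAffine_iteratedReLU (n : ℕ) : ¬ SegmentAffine (iteratedReLU (n + 1)) := by
  intro h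
  have h := h (Pi.single (Fin.last n) 1) (Pi.single (Fin.last n) (-1)) (1 / 2)
    (by norm_num) (by norm_num)
  have h0 : (1 / 2 : ℝ) • (Pi.single (Fin.last n) 1 : Fin (n + 1) → ℝ) +
      (1 - 1 / 2 : ℝ) • Pi.single (Fin.last n) (-1) = 0 := by
    rw [← Pi.single_smul, ← Pi.single_smul, ← Pi.single_add]
    norm_num
  rw [convexGap, h0, iteratedReLU_zero, iteratedReLU_single_last, iteratedReLU_single_last,
    relu_of_nonneg zero_le_one, relu_of_nonpos (by norm_num)] at h
  norm_num at h

/-! ### Rigidity of functions affine along `iteratedReLU` -/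

namespace AffineAlong

variable {n : ℕ} {h : (Fin n → ℝ) → ℝ}

theorem apply_smul_of_le_one (hh : AffineAlong (iteratedReLU n) h) {t : ℝ} (h0 : 0 ≤ t)
    (h1 : t ≤ 1) (x : Fin n → ℝ) : h (t • x) - h 0 = t * (h x - h 0) := by
  have := hh x 0 t h0 h1 (by simp [convexGap, iteratedReLU_smul h0, iteratedReLU_zero])
  simp only [convexGap, smul_zero, add_zero] at this
  linarith

theorem apply_smul (hh : AffineAlong (iteratedReLU n) h) {t : ℝ} (h0 : 0 ≤ t) (x : Fin n → ℝ) :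
    h (t • x) - h 0 = t * (h x - h 0) := by
  rcases le_total t 1 with h1 | h1
  · exact hh.apply_smul_of_le_one h0 h1 x
  · have ht : 0 < t := by linarith
    have := hh.apply_smul_of_le_one (inv_nonneg.2 h0) (inv_le_one_of_one_le₀ h1) (t • x)
    rw [inv_smul_smul₀ ht.ne'] at this
    rw [this, mul_inv_cancel_left₀ ht.ne']

theorem apply_add (hh : AffineAlong (iteratedReLU n) h) {x y : Fin n → ℝ}
    (hxy : iteratedReLU n (x + y) = iteratedReLU n x + iteratedReLU n y) :
    h (x + y) - h 0 = (h x - h 0) + (h y - h 0) := by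
  have e : (1 / 2 : ℝ) • (2 : ℝ) • x + (1 - 1 / 2 : ℝ) • (2 : ℝ) • y = x + y := by
    rw [smul_smul, smul_smul]
    norm_num
  have := hh ((2 : ℝ) • x) ((2 : ℝ) • y) (1 / 2) (by norm_num) (by norm_num) (by
    rw [convexGap, e, hxy, iteratedReLU_smul zero_le_two, iteratedReLU_smul zero_le_two]
    ring)
  rw [convexGap, e] at this
  have hx := hh.apply_smul zero_le_two x
  have hy := hh.apply_smul zero_le_two y
  linarith

/-- On the zero set, `h ≥ h 0`, since a smaller value would scale along its ray to a negative one.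
Adding `-|x|` to `x` stays in the zero set and, by monotonicity, cannot exceed `h 0`, so additivity
forces equality. -/
theorem eq_of_iteratedReLU_eq_zero (hh : AffineAlong (iteratedReLU n) h) (hm : Monotone h)
    (hpos : ∀ x, 0 ≤ h x) {x : Fin n → ℝ} (hx : iteratedReLU n x = 0) : h x = h 0 := by
  have key : ∀ y, iteratedReLU n y = 0 → h 0 ≤ h y := by
    intro y _
    by_contra! hlt
    have hd : 0 < h 0 - h y := by linarith
    -- This factor would bring `h` down to exactly `-1`.
    have h1 := hh.apply_smul (t := (h 0 + 1) / (h 0 - h y))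
      (div_nonneg (by linarith [hpos 0]) hd.le) y
    have h2 : (h 0 + 1) / (h 0 - h y) * (h y - h 0) = -(h 0 + 1) := by
      field_simp
      ring
    linarith [hpos (((h 0 + 1) / (h 0 - h y)) • y)]
  have hy : (fun i => -|x i| : Fin n → ℝ) ≤ 0 := fun i => neg_nonpos.2 (abs_nonneg _)
  have hxy : x + (fun i => -|x i|) ≤ 0 := fun i => by
    have := le_abs_self (x i)
    simp only [Pi.add_apply, Pi.zero_apply]
    linarith
  have hadd := hh.apply_add (x := x) (y := fun i => -|x i|) (by
    rw [iteratedReLU_of_nonpos hxy, iteratedReLU_of_nonpos hy, hx, add_zero])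
  linarith [key x hx, key _ (iteratedReLU_of_nonpos hy), hm hxy]

theorem eq_mul_iteratedReLU_add {n : ℕ} {h : (Fin (n + 1) → ℝ) → ℝ}
    (hh : AffineAlong (iteratedReLU (n + 1)) h) (hm : Monotone h) (hpos : ∀ x, 0 ≤ h x) :
    ∃ c b : ℝ, 0 ≤ c ∧ 0 ≤ b ∧ ∀ x, h x = c * iteratedReLU (n + 1) x + b := by
  refine ⟨h (Pi.single (Fin.last n) 1) - h 0, h 0,
    sub_nonneg.2 (hm (Pi.single_nonneg.2 zero_le_one)), hpos 0, fun x => ?_⟩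
  set M := iteratedReLU (n + 1) x with hM
  have hM0 : 0 ≤ M := iteratedReLU_nonneg x
  have hz := iteratedReLU_sub_single_last x
  rw [← hM] at hz
  -- Lowering the last coordinate by `M` lands in the zero set, so `h` is determined by its values
  -- there and on the last axis.
  have hadd := hh.apply_add (x := x - Pi.single (Fin.last n) M) (y := Pi.single (Fin.last n) M)
    (by rw [hz, sub_add_cancel, iteratedReLU_single_last, relu_of_nonneg hM0, zero_add])
  have hs := hh.apply_smul hM0 (Pi.single (Fin.last n) 1)
  rw [← Pi.single_smul, smul_eq_mul, mul_one] at hs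
  rw [sub_add_cancel, hh.eq_of_iteratedReLU_eq_zero hm hpos hz] at hadd
  linarith

end AffineAlong

/-! ### The depth lower bound -/

theorem convexGap_mul_add {n : ℕ} (f : (Fin n → ℝ) → ℝ) (c b : ℝ) (x y : Fin n → ℝ) (t : ℝ) :
    convexGap (fun x => c * f x + b) x y t = c * convexGap f x y t := by
  unfold convexGap
  ring

theorem affineAlong_mul_add {n : ℕ} (f : (Fin n → ℝ) → ℝ) (c b : ℝ) :
    AffineAlong f (fun x => c * f x + b) := fun x y t _ _ h => by
  rw [convexGap_mul_add, h, mul_zero]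

theorem SegmentAffine.of_mul_add {n : ℕ} {f : (Fin n → ℝ) → ℝ} {c b : ℝ} (hc : c ≠ 0)
    (h : SegmentAffine (fun x => c * f x + b)) : SegmentAffine f := fun x y t h0 h1 => by
  have := h x y t h0 h1
  rw [convexGap_mul_add] at this
  exact (mul_eq_zero.1 this).resolve_left hc

/-- A term with fewer than `n` nested `relu`s that is affine wherever `iteratedReLU n` is affine is
affine everywhere. -/
theorem MonotoneReLUTerm.segmentAffine {n k : ℕ} {f : (Fin n → ℝ) → ℝ}
    (hf : MonotoneReLUTerm n k f) (hk : k < n) (h : AffineAlong (iteratedReLU n) f) :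
    SegmentAffine f := by
  induction n generalizing k with
  | zero => omega
  | succ n ihn =>
    induction hf with
    | coord k i =>
      intro x y t _ _
      simp [convexGap]
    | const k c =>
      intro x y t _ _
      simp only [convexGap]
      ring
    | @add k f g hf hg ihf ihg =>
      have e : ∀ x y t, convexGap (fun x => f x + g x) x y t =
          convexGap f x y t + convexGap g x y t := fun x y t => by
        unfold convexGap
        ring
      have hsf := ihf hk fun x y t h0 h1 hxy => by
        have := h x y t h0 h1 hxy
        rw [e] at this
        linarith [hf.convexGap_nonneg x y h0 h1, hg.convexGap_nonneg x y h0 h1]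
      have hsg := ihg hk fun x y t h0 h1 hxy => by
        have := h x y t h0 h1 hxy
        rw [e] at this
        linarith [hf.convexGap_nonneg x y h0 h1, hg.convexGap_nonneg x y h0 h1]
      intro x y t h0 h1
      rw [e, hsf x y t h0 h1, hsg x y t h0 h1, add_zero]
    | @smul k f a ha hf ih =>
      have e : ∀ x y t, convexGap (fun x => a * f x) x y t = a * convexGap f x y t :=
        fun x y t => by simpa using convexGap_mul_add f a 0 x y t
      intro x y t h0 h1
      rw [e]
      rcases ha.eq_or_lt with rfl | ha
      · exact zero_mul _
      · refine mul_eq_zero_of_right a (ih hk (fun x y t h0 h1 hxy => ?_) x y t h0 h1)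
        have := h x y t h0 h1 hxy
        rw [e] at this
        exact (mul_eq_zero.1 this).resolve_left ha.ne'
    | @relu k g hg ih =>
      obtain ⟨c, b, hc, hb, hcb⟩ :=
        h.eq_mul_iteratedReLU_add hg.relu.monotone fun x => relu_nonneg (g x)
      rcases hb.eq_or_lt with rfl | hb
      · rcases hc.eq_or_lt with rfl | hc
        · intro x y t _ _
          simp [convexGap, hcb]
        · have e : (fun x => g (Fin.snoc (α := fun _ => ℝ) x 1)) =
              fun x => c * iteratedReLU n x + c := by
            ext x
            have hx : iteratedReLU (n + 1) (Fin.snoc (α := fun _ => ℝ) x 1) =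
                1 + iteratedReLU n x := by
              simp only [iteratedReLU, Fin.snoc_last, Fin.snoc_castSucc]
              exact relu_of_nonneg (by linarith [iteratedReLU_nonneg x])
            have hg1 := hcb (Fin.snoc (α := fun _ => ℝ) x 1)
            rw [hx] at hg1
            rw [← relu_eq_self_of_pos (t := g _), hg1]
            · ring
            · rw [hg1, add_zero]
              exact mul_pos hc (by linarith [iteratedReLU_nonneg x])
          have hs := hg.snoc 1
          rw [e] at hs
          have ha := (ihn hs (by omega) (affineAlong_mul_add _ c c)).of_mul_add hc.ne'
          -- The depth bound gives `k < n`, so `n` is positive; `iteratedReLU 0` would be affine.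
          obtain ⟨n, rfl⟩ : ∃ m, n = m + 1 := ⟨n - 1, by omega⟩
          exact absurd ha (not_segmentAffine_iteratedReLU n)
      · have e : (fun x => _root_.relu (g x)) = g := by
          ext x
          refine relu_eq_self_of_pos ?_
          rw [hcb x]
          have := mul_nonneg hc (iteratedReLU_nonneg x)
          linarith
        rw [e] at h ⊢
        exact ih (by omega) h

/-! ### The network of depth `n` -/

namespace ReLUGraph

variable {n m : ℕ} (G : ReLUGraph n m) (g : ReLUGate (Fin n ⊕ Fin m))

theorem gateVal_snoc_last (x : Fin n → ℝ) :
    (G.snoc g).gateVal x (Fin.last m) = g.eval (Sum.elim x (G.gateVal x)) :=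
  Fin.snoc_last (α := fun _ => ℝ) _ _

theorem gateDepth_snoc_last :
    (G.snoc g).gateDepth (Fin.last m) = g.depth (Sum.elim (fun _ => 0) G.gateDepth) :=
  Fin.snoc_last (α := fun _ => ℕ) _ _

theorem gateDepth_snoc_castSucc (i : Fin m) :
    (G.snoc g).gateDepth i.castSucc = G.gateDepth i :=
  Fin.snoc_castSucc (α := fun _ => ℕ) _ _ _

theorem gateDepth_snoc_le {d : ℕ} (hG : ∀ i, G.gateDepth i ≤ d)
    (hg : g.depth (Sum.elim (fun _ => 0) G.gateDepth) ≤ d) (i : Fin (m + 1)) :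
    (G.snoc g).gateDepth i ≤ d := by
  induction i using Fin.lastCases with
  | last => exact (gateDepth_snoc_last G g).trans_le hg
  | cast i => exact (gateDepth_snoc_castSucc G g i).trans_le (hG i)

end ReLUGraph

theorem exists_reLUGraph_iteratedReLU {n : ℕ} (m : ℕ) (hm : m ≤ n) :
    ∃ (s : ℕ) (G : ReLUGraph n s) (o : Fin s), G.IsMonotone ∧ (∀ i, G.gateDepth i ≤ m) ∧
      G.gateDepth o = m ∧
      ∀ x, G.gateVal x o = iteratedReLU m (fun i => x (Fin.castLE hm i)) := by
  induction m with
  | zero =>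
    refine ⟨1, .snoc .nil (.affine ∅ 0 0), Fin.last 0, And.intro trivial fun x y _ => ?_,
      ReLUGraph.gateDepth_snoc_le _ _ (fun i => i.elim0) le_rfl,
      ReLUGraph.gateDepth_snoc_last _ _, fun x => ?_⟩
    · simp [ReLUGate.eval]
    · rw [ReLUGraph.gateVal_snoc_last]
      simp [ReLUGate.eval, iteratedReLU]
  | succ m ih =>
    obtain ⟨s, G, o, hG, hd, ho, hv⟩ := ih (by omega)
    let i : Fin n := ⟨m, hm⟩
    let g : ReLUGate (Fin n ⊕ Fin s) := .affine {Sum.inl i, Sum.inr o} 1 0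
    have hg : g.depth (Sum.elim (fun _ => 0) G.gateDepth) = m := by
      simp [g, ReLUGate.depth, ho]
    have hg' : g.IsMonotone := fun w w' hw => by
      simp only [ReLUGate.eval, Pi.one_apply, one_mul, add_zero]
      exact Finset.sum_le_sum fun j _ => hw j
    have hr : (ReLUGate.relu (Sum.inr (Fin.last s))).depth
        (Sum.elim (fun _ : Fin n => 0) (G.snoc g).gateDepth) = m + 1 := by
      rw [ReLUGate.depth, Sum.elim_inr, ReLUGraph.gateDepth_snoc_last, hg]
    refine ⟨s + 2, (G.snoc g).snoc (.relu (Sum.inr (Fin.last s))), Fin.last _,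
      And.intro (And.intro hG hg') trivial, ReLUGraph.gateDepth_snoc_le _ _ (fun i =>
        (ReLUGraph.gateDepth_snoc_le _ _ hd hg.le i).trans (Nat.le_succ m)) hr.le,
      (ReLUGraph.gateDepth_snoc_last _ _).trans hr, fun x => ?_⟩
    rw [ReLUGraph.gateVal_snoc_last, ReLUGate.eval, Sum.elim_inr, ReLUGraph.gateVal_snoc_last]
    simp only [g, ReLUGate.eval, Pi.one_apply, one_mul, add_zero]
    rw [Finset.sum_pair Sum.inl_ne_inr, Sum.elim_inl, Sum.elim_inr, hv]
    rfl

theorem iteratedReLU_mem_monotoneReLU (n : ℕ) : iteratedReLU n ∈ MonotoneReLU n n := by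
  obtain ⟨s, G, o, hG, hd, ho, hv⟩ := exists_reLUGraph_iteratedReLU n le_rfl
  refine ⟨⟨s, G, Sum.inr o⟩, hG, le_antisymm (Finset.sup_le fun i _ => hd i) ?_, hv⟩
  exact ho.symm.le.trans (Finset.le_sup (f := G.gateDepth) (Finset.mem_univ o))

theorem mainTheorem3 (n : ℕ) (hn : 0 < n) :
    iteratedReLU n ∈ MonotoneReLU n n ∧ ∀ k : ℕ, k < n → iteratedReLU n ∉ MonotoneReLU n k := by
  refine ⟨iteratedReLU_mem_monotoneReLU n, fun k hk hmem => ?_⟩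
  have h := (MonotoneReLUTerm.of_mem_monotoneReLU hmem).segmentAffine hk fun _ _ _ _ _ h => h
  obtain ⟨m, rfl⟩ : ∃ m, n = m + 1 := ⟨n - 1, by omega⟩
  exact not_segmentAffine_iteratedReLU m h
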